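/- If $2^{\aleph_0}<2^{\aleph_1}$, then there is a semi-proper $(\aleph_2,\aleph_1)$-tree; moreover, it can be taken to be a set $T$ of binary sequences of length $<\omega_1$, closed under initial segments and ordered by end-extension, which is splitting and $\aleph_0$-fan closed. Here a $(\lambda,\kappa)$-tree is a tree in which every branch (maximal chain) has length less than $\kappa$ and every node has fewer than $\lambda$ immediate successors. Such a tree $T$ is semi-proper if $T$ itself, turned upside down and regarded as a forcing notion, adds a branch of length $\kappa$ to $T$, preserves stationary subsets of $\kappa$, and adds no new sets of cardinality less than $\kappa$. A tree is splitting if it has unique limits and every node has at least two immediate successors. An $\aleph_0$-fan of $T$ is a family of nodes $x_f$, indexed by the finite binary sequences $f$, such that for some strictly increasing sequence of ordinals $\langle\delta_n : n<\omega\rangle$ every $x_f$ has height $\delta_{\operatorname{dom} f}$ and is the infimum in $T$ of $x_{f^\frown\langle 0\rangle}$ and $x_{f^\frown\langle 1\rangle}$. The tree $T$ is $\aleph_0$-fan closed if every chain of length less than $\omega$ has an upper bound in $T$ and, for every $\aleph_0$-fan $\langle x_f\rangle$ of $T$, there are $b:\omega\to 2$ and a node of $T$ that extends $x_{b\restriction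 n}$ for every $n<\omega$. -/

import Mathlib

open Cardinal Ordinal Set

namespace SemiProperTree

universe u

/-! ### Trees -/

section Trees

variable {T : Type u} [PartialOrder T]

/-- The set `s`, with the order of `T`, has order type `α`. -/
def HasOrderType (s : Set T) (α : Ordinal.{u}) : Prop :=
  Nonempty (s ≃o α.ToType)

/-- The node `x` has height `α`. -/
def HasHeight (x : T) (α : Ordinal.{u}) : Prop :=
  HasOrderType (Iio x) α

/-- A branch is a maximal chain. -/
def IsBranch (B : Set T) : Prop :=
  IsMaxChain (· ≤ ·) B

variable (T) in
/-- A (set-theoretic, upward growing) tree: a partial order in which the predecessors of every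
node are well-ordered. -/
def IsTree : Prop :=
  ∀ x : T, IsWellOrder (Iio x) (· < ·)

variable (T) in
/-- A `(l, κ)`-tree: a tree in which every branch has length less than `κ` and every node has
less than `l` immediate successors. -/
structure IsCardTree (l κ : Cardinal.{u}) : Prop where
  isTree : IsTree T
  branch_lt : ∀ B : Set T, IsBranch B → ∃ α < κ.ord, HasOrderType B α
  succ_lt : ∀ x : T, #{y : T // x ⋖ y} < l

variable (T) in
/-- A splitting tree: it has unique limits (two nodes with the same predecessors, among which there
is no largest one, are equal), and every node has at least two immediate successors. -/
structure IsSplitting : Prop where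
  isTree : IsTree T
  unique_limits : ∀ x y : T, (∀ z < x, ∃ w, z < w ∧ w < x) → Iio x = Iio y → x = y
  two_succ : ∀ x : T, ∃ y z : T, x ⋖ y ∧ x ⋖ z ∧ y ≠ z

/-- `x`, indexed by the finite binary sequences, enumerates an `ℵ₀`-fan of `T` with levels `δ`.
(Continuity of `δ` is void for sequences of length `ω`.) -/
structure IsFan (δ : ℕ → Ordinal.{u}) (x : List Bool → T) : Prop where
  strictMono : StrictMono δ
  height : ∀ f : List Bool, HasHeight (x f) (δ f.length)
  inf : ∀ f : List Bool, IsGLB {x (f ++ [false]), x (f ++ [true])} (x f)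

variable (T) in
/-- `T` is `ℵ₀`-fan closed: it is `ℵ₀`-closed as a forcing notion (every chain of length less than
`ω` has an upper bound in the tree), and for every `ℵ₀`-fan of `T` some node of `T` extends one of
the cofinal branches of the fan. -/
structure IsFanClosed : Prop where
  closed : ∀ (n : ℕ) (c : Fin n → T), Monotone c → ∃ t, ∀ i, c i ≤ t
  fan : ∀ (δ : ℕ → Ordinal.{u}) (x : List Bool → T), IsFan δ x →
    ∃ (b : ℕ → Bool) (t : T), ∀ n : ℕ, x (List.ofFn fun i : Fin n => b i) ≤ t

end Trees

/-! ### Forcing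

A forcing notion is a nonempty preorder, with `p ≤ q` meaning that `p` is stronger than `q`. -/

/-- A statement of the forcing language, given by the set of the conditions that force it. -/
def Stmt (P : Type u) : Type u := P → Prop

/-- `p ⊩ φ`. -/
def Forces {P : Type u} (p : P) (φ : Stmt P) : Prop := φ p

/-- A name for a subset of a ground model set `X`: a set of pairs `(x, p)`. Every subset of `X` in
a generic extension has a name of this form, its value under the generic filter `G` being the set
of all `x` such that `(x, p)` belongs to the name for some `p ∈ G`. -/
abbrev Name (X P : Type u) : Type u := Set (X × P)

section Forcing

variable {P : Type u} [Preorder P]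

namespace Stmt

/-- A statement about the ground model. -/
def ground (φ : Prop) : Stmt P := fun _ => φ

/-- Conjunction. -/
def and (φ ψ : Stmt P) : Stmt P := fun p => Forces p φ ∧ Forces p ψ

/-- Implication. -/
def imp (φ ψ : Stmt P) : Stmt P := fun p => ∀ q ≤ p, Forces q φ → Forces q ψ

/-- Equivalence. -/
def iff (φ ψ : Stmt P) : Stmt P := (φ.imp ψ).and (ψ.imp φ)

/-- Universal quantification over a ground model set, or over names. -/
def all {X : Sort*} (φ : X → Stmt P) : Stmt P := fun p => ∀ x, Forces p (φ x)

/-- Existential quantification over a ground model set, or over names. -/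
def ex {X : Sort*} (φ : X → Stmt P) : Stmt P :=
  fun p => ∀ q ≤ p, ∃ r ≤ q, ∃ x, Forces r (φ x)

/-- The statement `x ∈ A`. -/
def mem {X : Type u} (x : X) (A : Name X P) : Stmt P :=
  fun p => ∀ q ≤ p, ∃ r ≤ q, ∃ s, r ≤ s ∧ (x, s) ∈ A

/-- The statement that `A` is an element of the ground model. -/
def inGround {X : Type u} (A : Name X P) : Stmt P :=
  ex fun B : Set X => all fun x : X => (mem x A).iff (ground (x ∈ B))

/-- The statement that `C` is a closed unbounded subset of the well-order `K`. -/
def isClub {K : Type u} [LinearOrder K] (C : Name K P) : Stmt P :=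
  -- unbounded
  (all fun a : K => ex fun b : K => (ground (a ≤ b)).and (mem b C)).and
  -- closed
  (all fun d : K =>
    ((ground (∃ a, a < d)).and
      (all fun a : K => (ground (a < d)).imp
        (ex fun b : K => (ground (a < b ∧ b < d)).and (mem b C)))).imp
    (mem d C))

/-- The statement that the ground model set `S ⊆ K` meets every closed unbounded subset of `K`. -/
def isStationary {K : Type u} [LinearOrder K] (S : Set K) : Stmt P :=
  all fun C : Name K P => (isClub C).imp
    (ex fun a : K => (ground (a ∈ S)).and (mem a C))

/-- The statement that `f` is a function from `D` onto `A`. -/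
def isSurjection {D X : Type u} (f : Name (D × X) P) (A : Name X P) : Stmt P :=
  -- `f` is total and its range is contained in `A`
  (all fun d : D => ex fun x : X => mem (d, x) f).and <|
  (all fun d : D => all fun x : X => (mem (d, x) f).imp (mem x A)).and <|
  -- `f` is single-valued
  (all fun d : D => all fun x : X => all fun y : X =>
    ((mem (d, x) f).and (mem (d, y) f)).imp (ground (x = y))).and <|
  -- every element of `A` is a value of `f`
  (all fun x : X => (mem x A).imp (ex fun d : D => mem (d, x) f))

/-- The statement that `f` is a strictly increasing function from `K` to `T` whose range is a
branch (a maximal chain) of `T`. -/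
def enumeratesBranch {K T : Type u} [LinearOrder K] [PartialOrder T]
    (f : Name (K × T) P) : Stmt P :=
  -- `f` is total
  (all fun a : K => ex fun x : T => mem (a, x) f).and <|
  -- `f` is single-valued
  (all fun a : K => all fun x : T => all fun y : T =>
    ((mem (a, x) f).and (mem (a, y) f)).imp (ground (x = y))).and <|
  -- `f` is strictly increasing
  (all fun a : K => all fun b : K => all fun x : T => all fun y : T =>
    ((ground (a < b)).and ((mem (a, x) f).and (mem (b, y) f))).imp (ground (x < y))).and <|
  -- every node that is comparable with all values of `f` is itself a value of `f`
  (all fun x : T =>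
    (all fun a : K => all fun y : T => (mem (a, y) f).imp (ground (x ≤ y ∨ y ≤ x))).imp
    (ex fun a : K => mem (a, x) f))

end Stmt

/-- Forcing with `P` adds a branch of length `κ` to `T`. -/
def AddsBranch (P : Type u) [Preorder P] (κ : Cardinal.{u}) (T : Type u) [PartialOrder T] : Prop :=
  ∃ f : Name (κ.ord.ToType × T) P, ∀ p : P, Forces p (Stmt.enumeratesBranch f)

/-- Forcing with `P` preserves stationary subsets of `κ`: every stationary subset of `κ` in the
ground model is forced to meet every closed unbounded subset of `κ` in the extension. -/
def PreservesStationary (P : Type u) [Preorder P] (κ : Cardinal.{u}) : Prop :=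
  ∀ S : Set κ.ord.ToType, IsStationary S → ∀ p : P, Forces p (Stmt.isStationary S)

/-- Forcing with `P` adds no sets of cardinality less than `κ`: every subset `A` of a ground model
set `X` that is, in the extension, the range of a function defined on an ordinal less than `κ`,
belongs to the ground model. (A new set of least rank is a subset of a ground model set, so it
suffices to consider these.) -/
def AddsNoSmallSets (P : Type u) [Preorder P] (κ : Cardinal.{u}) : Prop :=
  ∀ (X : Type u) (A : Name X P), ∀ α < κ.ord, ∀ (f : Name (α.ToType × X) P) (p : P),
    Forces p ((Stmt.isSurjection f A).imp (Stmt.inGround A))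

end Forcing

/-- A `(l, κ)`-tree `T` is (strongly) semi-proper if `T` itself, turned upside down and regarded as
a forcing notion, adds a `κ`-branch to `T`, preserves stationary subsets of `κ`, and adds no sets
of cardinality less than `κ`. -/
structure IsSemiProper (l κ : Cardinal.{u}) (T : Type u) [PartialOrder T] : Prop where
  isCardTree : IsCardTree T l κ
  nonempty : Nonempty T
  addsBranch : AddsBranch Tᵒᵈ κ T
  preservesStationary : PreservesStationary Tᵒᵈ κ
  addsNoSmallSets : AddsNoSmallSets Tᵒᵈ κ

/-! ### Binary sequences -/

/-- The set of transfinite binary sequences whose length is an element of the well-order `I`. For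
`I` of order type `ω₁`, this is the set of all binary sequences of length less than `ω₁`. -/
@[ext]
structure BinSeq (I : Type u) [LinearOrder I] : Type u where
  /-- The length of the sequence. -/
  len : I
  /-- The entries of the sequence. -/
  val : Iio len → Bool

/-- Binary sequences are ordered by end-extension. -/
instance (I : Type u) [LinearOrder I] : PartialOrder (BinSeq I) where
  le x y := ∃ h : x.len ≤ y.len, ∀ i : Iio x.len, y.val ⟨i.1, lt_of_lt_of_le i.2 h⟩ = x.val i
  le_refl x := ⟨le_rfl, fun _ => rfl⟩
  le_trans x y z := by
    rintro ⟨h, hv⟩ ⟨h', hv'⟩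
    exact ⟨h.trans h', fun i => (hv' ⟨i.1, lt_of_lt_of_le i.2 h⟩).trans (hv i)⟩
  le_antisymm x y := by
    rintro ⟨h, hv⟩ ⟨h', -⟩
    obtain ⟨a, f⟩ := x
    obtain ⟨b, g⟩ := y
    obtain rfl : a = b := le_antisymm h h'
    congr 1
    funext i
    exact (hv i).symm

end SemiProperTree

namespace SemiProperTree

open Order (succ IsSuccLimit)

/-! Since `2^ℵ₀ < 2^ℵ₁`, weak diamond holds (`exists_weakDiamond`): every colouring `F` of the
countable binary sequences is guessed by some `g : ω₁ → 2`, in the sense that each `f : ω₁ → 2` has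
a limit `c` with `F (f ↾ c) = g c`. Let `T` be the set of sequences none of whose initial segments
of limit length is guessed correctly. Then `T` has no uncountable branch. If moreover `F` is a
Bernstein colouring (`exists_bernstein`), every perfect system of sequences has limits of both
colours; so a system in `T` all of whose branches converge to level `c` has a limit of colour `!g
c`, and that limit is in `T` (`exists_isGregory`).

This weak closure does the work of countable closure, which `T` cannot have. Instead of one
descending sequence of conditions, a binary system is built in which all nodes of level `n + 1` meet
requirement `n`; whichever branch has a limit in `T`, the limit meets every requirement
(`exists_fusion`). If the construction is confined below a closure point `c`, the limit has length
exactly `c` (`exists_generic`). Arbitrary closure points give distributivity, hence no new countable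
sets; closure points in a given stationary set give its preservation. -/

/-- Well-orders of type `ω₁`, up to the cardinality of the order: initial segments are countable
and countable sets are strictly bounded. -/
class IsOmegaOne (I : Type) [LinearOrder I] : Prop where
  countable_Iic : ∀ a : I, (Iic a).Countable
  exists_gt_of_countable : ∀ s : Set I, s.Countable → ∃ b, ∀ a ∈ s, a < b

/-- The initial segment of length `n` of a binary sequence. -/
def pref (b : ℕ → Bool) (n : ℕ) : List Bool := List.ofFn fun i : Fin n => b i

theorem pref_succ (b : ℕ → Bool) (n : ℕ) : pref b (n + 1) = pref b n ++ [b n] := by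
  rw [pref, List.ofFn_succ', List.concat_eq_append]
  rfl

theorem length_pref (b : ℕ → Bool) (n : ℕ) : (pref b n).length = n := by
  simp [pref]

/-- A system of sets has an injective choice function as soon as its members are at least as large
as its index set. -/
theorem exists_injective_choice {ι X : Type} (A : ι → Set X) (hA : ∀ i, #ι ≤ #(A i)) :
    ∃ f : ι → X, Function.Injective f ∧ ∀ i, f i ∈ A i := by
  classical
  obtain ⟨r, wo, hr⟩ := Cardinal.exists_ord_eq ι
  -- In a well-order of `ι` of least type, fewer than `#ι` values are used before stage `i`, so `A
  -- i` still has an unused point.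
  have key : ∀ (i : ι) (g : ∀ j, r j i → X), ∃ y ∈ A i, ∀ j (h : r j i), g j h ≠ y := by
    intro i g
    by_contra! hcon
    have hsub : A i ⊆ range (fun j : {j // r j i} => g j.1 j.2) := by
      intro y hy
      obtain ⟨j, h, e⟩ := hcon y hy
      exact ⟨⟨j, h⟩, e⟩
    have h1 : #(A i) ≤ #{j // r j i} := (mk_le_mk_of_subset hsub).trans mk_range_le
    have h2 : #{j // r j i} < #ι := by
      have := Ordinal.typein_lt_type r i
      rw [← hr] at this
      exact Cardinal.lt_ord.1 this
    exact absurd ((hA i).trans h1) (not_le.2 h2)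
  choose F hF1 hF2 using key
  let f : ι → X := wo.toIsWellFounded.wf.fix F
  have hf : ∀ i, f i = F i fun j _ => f j := fun i => wo.toIsWellFounded.wf.fix_eq F i
  refine ⟨f, ?_, fun i => by rw [hf]; exact hF1 _ _⟩
  intro i j hij
  rcases trichotomous_of r i j with h | h | h
  · rw [hf j] at hij
    exact absurd hij (hF2 j (fun j _ => f j) i h)
  · exact h
  · rw [hf i] at hij
    exact absurd hij.symm (hF2 i (fun j _ => f j) j h)

/-! ### End-extension, restriction and one-step extension of sequences. -/

namespace BinSeq

variable {I : Type} [LinearOrder I]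

/-- The restriction of `f` to the predecessors of `c`. -/
def res (f : I → Bool) (c : I) : BinSeq I := ⟨c, fun i => f i⟩

/-- The extension of a sequence by the value `false`. -/
def ext0 (x : BinSeq I) (i : I) : Bool := if h : i < x.len then x.val ⟨i, h⟩ else false

theorem ext0_res {f : I → Bool} {c i : I} (h : i < c) : (res f c).ext0 i = f i := by
  simp [ext0, res, h]

theorem le_iff {x y : BinSeq I} :
    x ≤ y ↔ x.len ≤ y.len ∧ ∀ i < x.len, y.ext0 i = x.ext0 i := by
  constructor
  · rintro ⟨h, hv⟩
    refine ⟨h, fun i hi => ?_⟩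
    simp only [ext0, hi, hi.trans_le h, dite_true]
    exact hv ⟨i, hi⟩
  · rintro ⟨h, hv⟩
    refine ⟨h, fun i => ?_⟩
    have := hv i i.2
    have hi : i.1 < x.len := i.2
    simp only [ext0, hi, hi.trans_le h, dite_true] at this
    exact this

theorem len_le {x y : BinSeq I} (h : x ≤ y) : x.len ≤ y.len := (le_iff.1 h).1

theorem ext0_eq {x y : BinSeq I} (h : x ≤ y) {i : I} (hi : i < x.len) : y.ext0 i = x.ext0 i :=
  (le_iff.1 h).2 i hi

theorem le_of_le_of_le {x y z : BinSeq I} (hx : x ≤ z) (hy : y ≤ z) (h : x.len ≤ y.len) :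
    x ≤ y :=
  le_iff.2 ⟨h, fun _ hi => (ext0_eq hy (hi.trans_le h)).symm.trans (ext0_eq hx hi)⟩

theorem eq_of_le_of_le {x y z : BinSeq I} (hx : x ≤ z) (hy : y ≤ z) (h : x.len = y.len) :
    x = y :=
  le_antisymm (le_of_le_of_le hx hy h.le) (le_of_le_of_le hy hx h.ge)

theorem eq_of_le {x y : BinSeq I} (hx : x ≤ y) (h : x.len = y.len) : x = y :=
  eq_of_le_of_le hx le_rfl h

theorem len_lt {x y : BinSeq I} (h : x < y) : x.len < y.len :=
  (len_le h.le).lt_of_ne fun e => h.ne (eq_of_le h.le e)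

theorem lt_of_le_of_len_lt {x y : BinSeq I} (h : x ≤ y) (hl : x.len < y.len) : x < y :=
  h.lt_of_ne fun e => hl.ne (congrArg _ e)

theorem res_le (x : BinSeq I) {c : I} (h : c ≤ x.len) : res x.ext0 c ≤ x :=
  le_iff.2 ⟨h, fun _ hi => (ext0_res hi).symm⟩

theorem le_res {x : BinSeq I} {f : I → Bool} {c : I} (h : x.len ≤ c)
    (hf : ∀ i < x.len, f i = x.ext0 i) : x ≤ res f c :=
  le_iff.2 ⟨h, fun i hi => by rw [ext0_res (hi.trans_le h), hf i hi]⟩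

theorem res_congr {f g : I → Bool} {c : I} (h : ∀ i < c, f i = g i) : res f c = res g c := by
  simp only [res, BinSeq.mk.injEq, heq_eq_eq, true_and]
  funext i
  exact h i i.2

/-- The extension of a sequence by one entry. -/
def snoc [SuccOrder I] (x : BinSeq I) (i : Bool) : BinSeq I :=
  res (Function.update x.ext0 x.len i) (succ x.len)

section Snoc
variable [SuccOrder I]

@[simp] theorem len_snoc (x : BinSeq I) (i : Bool) : (x.snoc i).len = succ x.len := rfl

theorem le_snoc (x : BinSeq I) (i : Bool) : x ≤ x.snoc i :=
  le_res (Order.le_succ _) fun _ hj => Function.update_of_ne hj.ne _ _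

theorem ext0_snoc [NoMaxOrder I] (x : BinSeq I) (i : Bool) : (x.snoc i).ext0 x.len = i := by
  rw [snoc, ext0_res (Order.lt_succ _), Function.update_self]

theorem snoc_le [NoMaxOrder I] {x y : BinSeq I} (h : x ≤ y) (hl : x.len < y.len) :
    x.snoc (y.ext0 x.len) ≤ y := by
  refine le_iff.2 ⟨Order.succ_le_of_lt hl, fun i hi => ?_⟩
  rcases (Order.lt_succ_iff.1 hi).lt_or_eq with h' | rfl
  · rw [ext0_eq (le_snoc x _) h', ext0_eq h h']
  · rw [ext0_snoc]

end Snoc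

/-! ### Schemes. -/

/-- A perfect system of sequences, indexed by the finite binary sequences. -/
structure IsScheme (x : List Bool → BinSeq I) : Prop where
  le_append : ∀ f i, x f ≤ x (f ++ [i])
  not_le : ∀ f z, x (f ++ [false]) ≤ z → ¬ x (f ++ [true]) ≤ z

theorem IsScheme.monotone {x : List Bool → BinSeq I} (hx : IsScheme x) (b : ℕ → Bool) :
    Monotone fun n => x (pref b n) :=
  monotone_nat_of_le_succ fun n => by rw [pref_succ]; exact hx.le_append _ _

theorem IsScheme.branch_unique {x : List Bool → BinSeq I} (hx : IsScheme x) {b c : ℕ → Bool}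
    {u : BinSeq I} (hb : ∀ n, x (pref b n) ≤ u) (hc : ∀ n, x (pref c n) ≤ u) : b = c := by
  suffices h : ∀ n, pref b n = pref c n by
    funext n
    have := h (n + 1)
    rw [pref_succ, pref_succ, h n] at this
    simpa using this
  intro n
  induction n with
  | zero => rfl
  | succ n ih =>
    have h1 := hb (n + 1)
    have h2 := hc (n + 1)
    rw [pref_succ, ih] at h1
    rw [pref_succ] at h2
    rw [pref_succ, pref_succ, ih]
    cases hbn : b n <;> cases hcn : c n <;> rw [hbn] at h1 <;> rw [hcn] at h2
    · exact absurd h2 (hx.not_le _ _ h1)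
    · exact absurd h1 (hx.not_le _ _ h2)

/-! ### Weak diamond. -/

/-- A form of the weak diamond principle. -/
theorem exists_weakDiamond [WellFoundedLT I] [SuccOrder I] [OrderBot I]
    (hI : (2 : Cardinal) ^ ℵ₀ < 2 ^ #I) (F : BinSeq I → Bool) :
    ∃ g : I → Bool, ∀ f : I → Bool, ∃ c, IsSuccLimit c ∧ F (res f c) = g c := by
  by_contra! hcon
  have hcon' : ∀ h : I → Bool, ∃ f : I → Bool, ∀ c, IsSuccLimit c → F (res f c) = h c := by
    intro h
    obtain ⟨f, hf⟩ := hcon fun c => !h c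
    exact ⟨f, fun c hc => by simpa using hf c hc⟩
  choose Φ hΦ using hcon'
  -- The function at `k :: s` codes the one at `s`: applied to its restriction to a limit `c`, `F`
  -- returns the value of the latter at `c + k`. All finite lists are needed, because decoding one
  -- function below `c + k` uses the next one below `c`.
  let f : (I → Bool) → List ℕ → I → Bool := fun h s =>
    s.rec h fun k _ p => Φ fun c => p (succ^[k] c)
  have f_nil : ∀ h, f h [] = h := fun _ => rfl
  have f_cons : ∀ h k s, f h (k :: s) = Φ fun c => f h s (succ^[k] c) := fun _ _ _ => rfl
  have decomp : ∀ a : I, ∃ (c : I) (k : ℕ), (c = ⊥ ∨ IsSuccLimit c) ∧ succ^[k] c = a := by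
    intro a
    induction a using WellFoundedLT.induction with
    | _ a ih =>
      by_cases ha : IsSuccLimit a
      · exact ⟨a, 0, Or.inr ha, rfl⟩
      · rcases eq_or_ne a ⊥ with rfl | hne
        · exact ⟨⊥, 0, Or.inl rfl, rfl⟩
        · have hm : ¬ IsMin a := fun h => hne (isMin_iff_eq_bot.1 h)
          have : ¬ Order.IsSuccPrelimit a := fun h => ha ⟨hm, h⟩
          obtain ⟨b, hb⟩ : ∃ b, b ⋖ a := by simpa [Order.IsSuccPrelimit] using this
          obtain ⟨c, k, hc, rfl⟩ := ih b hb.lt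
          exact ⟨c, k + 1, hc, (Function.iterate_succ_apply' _ _ _).trans hb.succ_eq⟩
  -- The values at finite ordinals of these countably many functions determine all of them by
  -- induction, and so determine `h`. Thus `2 ^ #I ≤ 2 ^ ℵ₀`.
  have hinj : Function.Injective fun (h : I → Bool) (p : List ℕ × ℕ) =>
      f h p.1 (succ^[p.2] ⊥) := by
    intro h h' e
    suffices key : ∀ a s, f h s a = f h' s a by
      funext a
      simpa [f_nil] using key a []
    intro a
    induction a using WellFoundedLT.induction with
    | _ a ih =>
      intro s
      obtain ⟨c, k, rfl | hc, rfl⟩ := decomp a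
      · exact congrFun e (s, k)
      · have hca : c ≤ succ^[k] c := Order.le_succ_iterate k c
        have h1 := hΦ (fun c => f h s (succ^[k] c)) c hc
        have h2 := hΦ (fun c => f h' s (succ^[k] c)) c hc
        rw [← f_cons] at h1 h2
        rw [← h1, ← h2]
        exact congrArg F (res_congr fun i hi => ih i (hi.trans_le hca) (k :: s))
  have := mk_le_of_injective hinj
  rw [← power_def, ← power_def, mk_bool, Cardinal.mk_eq_aleph0 (List ℕ × ℕ)] at this
  exact absurd this (not_le.2 hI)

/-! ### Limits of schemes, the Bernstein colouring and the tree. -/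

/-- The unions of the branches of a scheme. -/
def limits (x : List Bool → BinSeq I) : Set (BinSeq I) :=
  {u | ∃ b, (∀ n, x (pref b n) ≤ u) ∧ ∀ a < u.len, ∃ n, a < (x (pref b n)).len}

/-- A sequence is coded by its length and, through a fixed injection of that length into `ℕ`, a set
of natural numbers. -/
theorem mk_le_continuum [IsOmegaOne I] (hI : #I ≤ 𝔠) : #(BinSeq I) ≤ 𝔠 := by
  have hc : ∀ a : I, Countable (Iio a) := fun a =>
    ((IsOmegaOne.countable_Iic a).mono Iio_subset_Iic_self).to_subtype
  choose e he using fun a : I => (countable_iff_exists_injective (Iio a)).1 (hc a)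
  have hinj : Function.Injective fun x : BinSeq I =>
      ((x.len, {n | ∃ i, e x.len i = n ∧ x.val i = true}) : I × Set ℕ) := by
    rintro ⟨a, v⟩ ⟨b, w⟩ h
    simp only [Prod.mk.injEq] at h
    obtain ⟨rfl, h⟩ := h
    congr 1
    funext i
    have := Set.ext_iff.1 h (e a i)
    simp only [mem_ofPred_eq, (he a).eq_iff, exists_eq_left] at this
    exact Bool.eq_iff_iff.2 this
  refine (mk_le_of_injective hinj).trans ?_
  have : #(Set ℕ) = 𝔠 := by simp
  rw [mk_prod, Cardinal.lift_id, Cardinal.lift_id, this]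
  exact (mul_le_mul_left hI _).trans (continuum_mul_self).le

/-- A tree of countable binary sequences without uncountable branches, in which every scheme
converging to a level has a limit. -/
structure IsGregory [SuccOrder I] (T : Set (BinSeq I)) : Prop where
  lower : IsLowerSet T
  nonempty : T.Nonempty
  snoc_mem : ∀ x ∈ T, ∀ i, x.snoc i ∈ T
  no_branch : ∀ f : I → Bool, ∃ c, res f c ∉ T
  exists_limit : ∀ x : List Bool → BinSeq I, IsScheme x → (∀ f, x f ∈ T) → ∀ c,
    (∀ f, (x f).len < c) → (∀ b, ∀ a < c, ∃ n, a < (x (pref b n)).len) →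
    ∃ b, ∃ u ∈ T, u.len = c ∧ ∀ n, x (pref b n) ≤ u

section OmegaOne
variable [WellFoundedLT I] [IsOmegaOne I]

theorem exists_union {y : ℕ → BinSeq I} (hy : Monotone y) :
    ∃ u, (∀ n, y n ≤ u) ∧ ∀ a < u.len, ∃ n, a < (y n).len := by
  classical
  let s : Set I := {c | ∀ n, (y n).len ≤ c}
  have hs : s.Nonempty := by
    obtain ⟨b, hb⟩ := IsOmegaOne.exists_gt_of_countable (range fun n => (y n).len)
      (countable_range _)
    exact ⟨b, fun n => (hb _ ⟨n, rfl⟩).le⟩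
  -- Being the least upper bound of the lengths, `c` has no gap above them; this gives the
  -- cofinality claim.
  let c := wellFounded_lt.min s hs
  have hc : ∀ n, (y n).len ≤ c := wellFounded_lt.min_mem s hs
  let f : I → Bool := fun i => if h : ∃ n, i < (y n).len then (y h.choose).ext0 i else false
  refine ⟨res f c, fun n => le_res (hc n) fun i hi => ?_, fun a ha => ?_⟩
  · have h : ∃ n, i < (y n).len := ⟨n, hi⟩
    have e : f i = (y h.choose).ext0 i := dif_pos h
    rw [e]
    rcases le_total n h.choose with h' | h'
    · exact ext0_eq (hy h') hi
    · exact (ext0_eq (hy h') h.choose_spec).symm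
  · by_contra! hcon
    exact wellFounded_lt.not_lt_min s (show a ∈ s from hcon) ha

/-- Different branches split at some node, so they have different unions. -/
theorem IsScheme.continuum_le_limits {x : List Bool → BinSeq I} (hx : IsScheme x) :
    𝔠 ≤ #(limits x) := by
  choose u hu1 hu2 using fun b => exists_union (hx.monotone b)
  have : #(ℕ → Bool) = 𝔠 := by simp
  rw [← this]
  refine mk_le_of_injective (f := fun b => (⟨u b, b, hu1 b, hu2 b⟩ : limits x)) fun b c h => ?_
  have h' : u b = u c := congrArg Subtype.val h
  exact hx.branch_unique (hu1 b) (h' ▸ hu1 c)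

/-- A Bernstein colouring: both colours occur among the limits of every scheme. -/
theorem exists_bernstein (hI : #I ≤ 𝔠) :
    ∃ F : BinSeq I → Bool, ∀ x, IsScheme x → ∀ v, ∃ u ∈ limits x, F u = v := by
  classical
  -- There are at most `𝔠 ^ ℵ₀ = 𝔠` pairs of a scheme and a colour, and each scheme has at least `𝔠`
  -- limits. So the pairs can be given distinct limits, to be coloured as the pairs prescribe.
  let A : {x : List Bool → BinSeq I // IsScheme x} × Bool → Set (BinSeq I) := fun p => limits p.1.1
  have hι : #({x : List Bool → BinSeq I // IsScheme x} × Bool) ≤ 𝔠 := by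
    have h1 : #{x : List Bool → BinSeq I // IsScheme x} ≤ 𝔠 := by
      refine (mk_subtype_le _).trans ?_
      rw [← power_def, mk_list_eq_aleph0]
      exact (power_le_power_right (mk_le_continuum hI)).trans continuum_power_aleph0.le
    rw [mk_prod, Cardinal.lift_id, Cardinal.lift_id]
    exact (mul_le_mul' h1 (by simpa using (nat_lt_continuum 2).le)).trans continuum_mul_self.le
  obtain ⟨f, hf, hfA⟩ := exists_injective_choice A fun p =>
    hι.trans p.1.2.continuum_le_limits
  refine ⟨fun u => decide (∃ x, f (x, true) = u), fun x hx v => ⟨f (⟨x, hx⟩, v), hfA (⟨x, hx⟩, v), ?_⟩⟩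
  cases v with
  | true => simp
  | false => simp [hf.eq_iff]

theorem exists_isGregory [SuccOrder I] [OrderBot I] [NoMaxOrder I] (hI : #I ≤ 𝔠)
    (hI' : (2 : Cardinal) ^ ℵ₀ < 2 ^ #I) : ∃ T : Set (BinSeq I), IsGregory T := by
  obtain ⟨F, hF⟩ := exists_bernstein hI
  obtain ⟨g, hg⟩ := exists_weakDiamond hI' F
  refine ⟨{x | ∀ y ≤ x, IsSuccLimit y.len → F y ≠ g y.len}, ?_, ?_, ?_, ?_, ?_⟩
  · exact fun x y hyx hx z hz => hx z (hz.trans hyx)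
  · refine ⟨res (fun _ => false) ⊥, fun y hy hl => absurd ?_ hl.1⟩
    have : y.len = ⊥ := le_bot_iff.1 (len_le hy)
    rw [this]
    exact isMin_bot
  · intro x hx i y hy hl
    have hle := len_le hy
    have hlt : y.len < succ x.len := lt_of_le_of_ne hle fun e =>
      (Order.isSuccPrelimit_iff_succ_ne.1 hl.2) x.len e.symm
    exact hx y (le_of_le_of_le hy (le_snoc x i) (Order.lt_succ_iff.1 hlt)) hl
  · intro f
    obtain ⟨c, hc, e⟩ := hg f
    exact ⟨c, fun h => h _ le_rfl hc e⟩
  · intro x hx hxT c hlt hcof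
    -- The colour is chosen against the guess at `c`, the only level of `u` not already controlled
    -- by the scheme.
    obtain ⟨u, ⟨b, hbu, hub⟩, hu⟩ := hF x hx (!g c)
    have hlen : u.len = c := by
      refine le_antisymm (not_lt.1 fun h => ?_) (not_lt.1 fun h => ?_)
      · obtain ⟨n, hn⟩ := hub c h
        exact lt_asymm hn (hlt _)
      · obtain ⟨n, hn⟩ := hcof b _ h
        exact absurd (len_le (hbu n)) (not_le.2 hn)
    refine ⟨b, u, fun y hy hl => ?_, hlen, hbu⟩
    rcases (len_le hy).lt_or_eq with h | h
    · obtain ⟨n, hn⟩ := hub _ h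
      exact hxT _ y (le_of_le_of_le hy (hbu n) hn.le) hl
    · obtain rfl := eq_of_le hy h
      rw [hu, hlen]
      simp

end OmegaOne

end BinSeq

/-! ### Closure points of a function form a club. -/

section Club
variable {I : Type} [LinearOrder I] [WellFoundedLT I] [IsOmegaOne I]

theorem isClub_closurePoints (h : I → I) :
    IsClub {c : I | (∃ a, a < c) ∧ ∀ a < c, h a < c} := by
  constructor
  · rintro s hs ⟨d, hd⟩ - c hc
    refine ⟨(hs hd).1.imp fun a ha => ha.trans_le (hc.1 hd), fun a ha => ?_⟩
    obtain ⟨e, he, hae⟩ := (lt_isLUB_iff hc).1 ha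
    exact ((hs he).2 a hae).trans_le (hc.1 he)
  · intro a
    have hstep : ∀ c : I, ∃ d, c < d ∧ ∀ b ≤ c, h b < d := by
      intro c
      obtain ⟨d, hd⟩ := IsOmegaOne.exists_gt_of_countable (insert c (h '' Iic c))
        (((IsOmegaOne.countable_Iic c).image h).insert c)
      exact ⟨d, hd _ (mem_insert _ _), fun b hb => hd _ (mem_insert_of_mem _ ⟨b, hb, rfl⟩)⟩
    choose k hk1 hk2 using hstep
    let u : ℕ → I := fun n => k^[n] a
    have hu : ∀ n, u (n + 1) = k (u n) := fun n => Function.iterate_succ_apply' k n a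
    -- The supremum of the iterates of `k` is a closure point: any `b` below it is at most some `u
    -- n`, whence `h b < u (n + 1)`.
    let s : Set I := {c | ∀ n, u n < c}
    have hs : s.Nonempty := by
      obtain ⟨b, hb⟩ := IsOmegaOne.exists_gt_of_countable (range u) (countable_range u)
      exact ⟨b, fun n => hb _ ⟨n, rfl⟩⟩
    have hmem : ∀ n, u n < wellFounded_lt.min s hs := wellFounded_lt.min_mem s hs
    refine ⟨wellFounded_lt.min s hs, ⟨⟨a, hmem 0⟩, fun b hb => ?_⟩, (hmem 0).le⟩
    have hb' : b ∉ s := fun hb' => wellFounded_lt.not_lt_min s hb' hb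
    simp only [s, mem_ofPred_eq, not_forall, not_lt] at hb'
    obtain ⟨n, hn⟩ := hb'
    exact (hk2 _ _ hn).trans (by rw [← hu]; exact hmem _)

end Club

/-! ### Fusion and generic nodes. -/

namespace BinSeq
namespace IsGregory

variable {I : Type} [LinearOrder I] [SuccOrder I] {T : Set (BinSeq I)}

variable [NoMaxOrder I]

/-- A family of nodes in which every requirement can be met above every node, in both directions,
has limits which meet all requirements. -/
theorem exists_fusion (hT : IsGregory T) {N : Set (BinSeq I)} (hN : N ⊆ T) {c : I}
    (hc : ∀ y ∈ N, y.len < c) (R : ℕ → BinSeq I → Prop)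
    (hR : ∀ n, ∀ y ∈ N, ∀ i, ∃ z ∈ N, y.snoc i ≤ z ∧ R n z)
    (hcof : ∀ a < c, ∃ n, ∀ z, R n z → a < z.len) {p : BinSeq I} (hp : p ∈ N) :
    ∃ u ∈ T, p ≤ u ∧ u.len = c ∧ ∀ n, ∃ z ∈ N, z ≤ u ∧ R n z := by
  choose! σ hσ1 hσ2 hσ3 using hR
  -- List recursion adds entries at the head while schemes grow at the end, hence the reversal.
  -- Passing through `snoc i` makes the two successors incompatible.
  let y : List Bool → BinSeq I := fun f => f.rec p fun i l z => σ l.length z i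
  let x : List Bool → BinSeq I := fun f => y f.reverse
  have hx_nil : x [] = p := rfl
  have hx_app : ∀ f i, x (f ++ [i]) = σ f.length (x f) i := by
    intro f i
    simp only [x, List.reverse_append, List.reverse_cons, List.reverse_nil, List.nil_append,
      List.singleton_append]
    change σ f.reverse.length _ i = _
    rw [List.length_reverse]
  have hxN : ∀ f, x f ∈ N := by
    intro f
    induction f using List.reverseRecOn with
    | nil => exact hp
    | append_singleton f i ih => rw [hx_app]; exact hσ1 _ _ ih _
  have hsn : ∀ f i, (x f).snoc i ≤ x (f ++ [i]) := by
    intro f i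
    rw [hx_app]
    exact hσ2 _ _ (hxN f) i
  have hRx : ∀ f i, R f.length (x (f ++ [i])) := by
    intro f i
    rw [hx_app]
    exact hσ3 _ _ (hxN f) i
  have hscheme : IsScheme x := by
    refine ⟨fun f i => (le_snoc _ _).trans (hsn f i), fun f z h0 h1 => ?_⟩
    have hl : ∀ i, (x f).len < ((x f).snoc i).len := fun i => Order.lt_succ _
    have e0 := ext0_eq ((hsn f _).trans h0) (hl _)
    have e1 := ext0_eq ((hsn f _).trans h1) (hl _)
    rw [ext0_snoc] at e0 e1
    exact Bool.noConfusion (e0.symm.trans e1)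
  obtain ⟨b, u, hu, hlen, hbu⟩ := hT.exists_limit x hscheme (fun f => hN (hxN f)) c
    (fun f => hc _ (hxN f)) (fun b a ha => by
      obtain ⟨n, hn⟩ := hcof a ha
      refine ⟨n + 1, hn _ ?_⟩
      rw [pref_succ]
      simpa [length_pref] using hRx (pref b n) (b n))
  refine ⟨u, hu, hbu 0, hlen, fun n => ⟨x (pref b (n + 1)), hxN _, hbu _, ?_⟩⟩
  rw [pref_succ]
  simpa [length_pref] using hRx (pref b n) (b n)

variable [WellFoundedLT I] [IsOmegaOne I]

/-- At a limit `c`, fusion is applied to the nodes shorter than `c`; the requirements are to exceed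
each of the countably many ordinals below `c`. -/
theorem exists_extension_len_eq (hT : IsGregory T) (c : I) :
    ∀ x ∈ T, x.len ≤ c → ∃ y ∈ T, x ≤ y ∧ y.len = c := by
  induction c using WellFoundedLT.induction with
  | _ c ih =>
    intro x hx hxc
    rcases hxc.eq_or_lt with hxc | hxc
    · exact ⟨x, hx, le_rfl, hxc⟩
    by_cases hc : Order.IsSuccPrelimit c
    · have : Nonempty (Iio c) := ⟨⟨_, hxc⟩⟩
      have : Countable (Iio c) :=
        ((IsOmegaOne.countable_Iic c).mono Iio_subset_Iic_self).to_subtype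
      obtain ⟨e, he⟩ := exists_surjective_nat (Iio c)
      have hlim : IsSuccLimit c := ⟨fun h => (not_lt_of_ge (h hxc.le)) hxc, hc⟩
      obtain ⟨u, hu, hxu, hlen, -⟩ := hT.exists_fusion (N := {y ∈ T | y.len < c}) (c := c)
        (fun y hy => hy.1) (fun y hy => hy.2) (fun n z => (e n).1 < z.len)
        (fun n y hy i => by
          have hd : max (succ (e n).1) (succ y.len) < c :=
            max_lt (hlim.succ_lt (e n).2) (hlim.succ_lt hy.2)
          obtain ⟨z, hz, hyz, hzl⟩ := ih _ hd (y.snoc i) (hT.snoc_mem y hy.1 i) (le_max_right _ _)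
          refine ⟨z, ⟨hz, hzl.trans_lt hd⟩, hyz, ?_⟩
          rw [hzl]
          exact (Order.lt_succ _).trans_le (le_max_left _ _))
        (fun a ha => by
          obtain ⟨n, hn⟩ := he ⟨a, ha⟩
          exact ⟨n, fun z hz => by rw [hn] at hz; exact hz⟩) (p := x) ⟨hx, hxc⟩
      exact ⟨u, hu, hxu, hlen⟩
    · obtain ⟨b, hb⟩ : ∃ b, b ⋖ c := by simpa [Order.IsSuccPrelimit] using hc
      have hxb : x.len ≤ b := Order.lt_succ_iff.1 (hxc.trans_eq hb.succ_eq.symm)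
      obtain ⟨y, hy, hxy, hyl⟩ := ih b hb.lt x hx hxb
      exact ⟨y.snoc false, hT.snoc_mem y hy _, hxy.trans (le_snoc y _), by
        rw [len_snoc, hyl, hb.succ_eq]⟩

theorem exists_extension_lt_len (hT : IsGregory T) {x : BinSeq I} (hx : x ∈ T) (c : I) :
    ∃ y ∈ T, x ≤ y ∧ c < y.len := by
  obtain ⟨y, hy, hxy, hl⟩ := hT.exists_extension_len_eq (max x.len (succ c)) x hx
    (le_max_left _ _)
  exact ⟨y, hy, hxy, hl ▸ (Order.lt_succ c).trans_le (le_max_right _ _)⟩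

/-- Countably many requirements, which can be met densely often above `p`, are met by the
predecessors of nodes above `p` of all lengths in a closed unbounded set. -/
theorem exists_generic (hT : IsGregory T) {J : Type} [Countable J] [Nonempty J]
    (R : J → I → BinSeq I → Prop) {p : BinSeq I} (hp : p ∈ T)
    (hR : ∀ j a, ∀ y ∈ T, p ≤ y → ∃ z ∈ T, y ≤ z ∧ R j a z) :
    ∃ h : I → I, ∀ c : I, (∃ a, a < c) → (∀ a < c, h a < c) →
      ∃ u ∈ T, p ≤ u ∧ u.len = c ∧ ∀ j, ∀ a < c, ∃ z ≤ u, z.len < c ∧ R j a z := by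
  -- Since `R` need not persist to extensions, the node `w` that meets it is kept apart from the
  -- longer `z`.
  have hR' : ∀ j a y i, y ∈ T → p ≤ y → ∃ z ∈ T, y.snoc i ≤ z ∧ a < z.len ∧
      ∃ w ≤ z, R j a w := by
    intro j a y i hy hpy
    obtain ⟨w, hw, hyw, hwR⟩ := hR j a (y.snoc i) (hT.snoc_mem y hy i) (hpy.trans (le_snoc y i))
    obtain ⟨z, hz, hwz, hzl⟩ := hT.exists_extension_lt_len hw a
    exact ⟨z, hz, hyw.trans hwz, hzl, w, hwz, hwR⟩
  choose! σ hσT hσle hσlt hσR using hR'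
  -- Nodes are indexed by finite lists of moves. Only countably many lists use ordinals at most `a`,
  -- so `h a` can bound the lengths of their nodes.
  let val : List (J × I × Bool) → BinSeq I := fun l =>
    l.rec p fun q _ y => σ q.1 q.2.1 y q.2.2
  have hval : ∀ l, val l ∈ T ∧ p ≤ val l := by
    intro l
    induction l with
    | nil => exact ⟨hp, le_rfl⟩
    | cons q l ih =>
      exact ⟨hσT _ _ _ _ ih.1 ih.2, (ih.2.trans (le_snoc _ q.2.2)).trans (hσle _ _ _ _ ih.1 ih.2)⟩
  have hbound : ∀ a : I, ∃ d, ∀ l : List (J × I × Bool), (∀ q ∈ l, q.2.1 ≤ a) →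
      (val l).len < d := by
    intro a
    have : Countable (Iic a) := (IsOmegaOne.countable_Iic a).to_subtype
    obtain ⟨d, hd⟩ := IsOmegaOne.exists_gt_of_countable
      (range fun l : List (J × Iic a × Bool) => (val (l.map fun q => (q.1, q.2.1.1, q.2.2))).len)
      (countable_range _)
    refine ⟨d, fun l hl => hd _ ⟨l.attach.map fun q => (q.1.1, ⟨q.1.2.1, hl _ q.2⟩, q.1.2.2), ?_⟩⟩
    simp only [List.map_map]
    exact congrArg (fun l => (val l).len) l.attach_map_subtype_val
  choose h hh using hbound
  refine ⟨h, fun c ⟨a₀, ha₀⟩ hc => ?_⟩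
  have : Nonempty (Iio c) := ⟨⟨a₀, ha₀⟩⟩
  have : Countable (Iio c) := ((IsOmegaOne.countable_Iic c).mono Iio_subset_Iic_self).to_subtype
  obtain ⟨e, he⟩ := exists_surjective_nat (J × Iio c)
  -- For a closure point `c`, the lists with ordinals below `c` yield nodes shorter than `c` and are
  -- closed under further such moves, as fusion needs.
  let N : Set (BinSeq I) := {y | ∃ l, (∀ q ∈ l, q.2.1 < c) ∧ val l = y}
  have hNlt : ∀ y ∈ N, y.len < c := by
    rintro _ ⟨l, hl, rfl⟩
    have : ∃ a < c, ∀ q ∈ l, q.2.1 ≤ a := by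
      clear_value val
      induction l with
      | nil => exact ⟨a₀, ha₀, by simp⟩
      | cons q l ih =>
        obtain ⟨a, ha, hla⟩ := ih fun q hq => hl q (List.mem_cons_of_mem _ hq)
        refine ⟨max a q.2.1, max_lt ha (hl q List.mem_cons_self), fun r hr => ?_⟩
        rcases List.mem_cons.1 hr with rfl | hr
        · exact le_max_right _ _
        · exact (hla r hr).trans (le_max_left _ _)
    obtain ⟨a, ha, hla⟩ := this
    exact (hh a l hla).trans (hc a ha)
  obtain ⟨u, hu, hpu, hlen, hz⟩ := hT.exists_fusion (N := N) (c := c)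
    (by rintro _ ⟨l, -, rfl⟩; exact (hval l).1) hNlt
    (fun n z => (e n).2.1 < z.len ∧ ∃ w ≤ z, R (e n).1 (e n).2 w)
    (by
      rintro n _ ⟨l, hl, rfl⟩ i
      obtain ⟨h1, h2⟩ := hval l
      refine ⟨_, ⟨((e n).1, (e n).2.1, i) :: l, ?_, rfl⟩, hσle _ _ _ _ h1 h2,
        hσlt _ _ _ _ h1 h2, hσR _ _ _ _ h1 h2⟩
      intro q hq
      rcases List.mem_cons.1 hq with rfl | hq
      · exact (e n).2.2
      · exact hl q hq)
    (fun a ha => by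
      obtain ⟨n, hn⟩ := he (Classical.arbitrary J, ⟨a, ha⟩)
      exact ⟨n, fun z hz => by rw [hn] at hz; exact hz.1⟩)
    (p := p) ⟨[], by simp, rfl⟩
  refine ⟨u, hu, hpu, hlen, fun j a ha => ?_⟩
  obtain ⟨n, hn⟩ := he (j, ⟨a, ha⟩)
  obtain ⟨z, hzN, hzu, -, w, hwz, hw⟩ := hz n
  rw [hn] at hw
  exact ⟨w, hwz.trans hzu, (len_le hwz).trans_lt (hNlt z hzN), hw⟩

end IsGregory
end BinSeq

/-! ### Unfolding the forcing relation; distributivity. -/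

section Forcing
variable {P : Type}

@[simp] theorem forces_ground {p : P} {φ : Prop} : Forces p (Stmt.ground φ) ↔ φ := Iff.rfl

@[simp] theorem forces_and {p : P} {φ ψ : Stmt P} :
    Forces p (φ.and ψ) ↔ Forces p φ ∧ Forces p ψ := Iff.rfl

@[simp] theorem forces_all {p : P} {X : Sort*} {φ : X → Stmt P} :
    Forces p (Stmt.all φ) ↔ ∀ x, Forces p (φ x) := Iff.rfl

variable [Preorder P]

@[simp] theorem forces_imp {p : P} {φ ψ : Stmt P} :
    Forces p (φ.imp ψ) ↔ ∀ q ≤ p, Forces q φ → Forces q ψ := Iff.rfl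

@[simp] theorem forces_ex {p : P} {X : Sort*} {φ : X → Stmt P} :
    Forces p (Stmt.ex φ) ↔ ∀ q ≤ p, ∃ r ≤ q, ∃ x, Forces r (φ x) := Iff.rfl

theorem forces_mem_mono {p q : P} (h : q ≤ p) {X : Type} {x : X} {A : Name X P}
    (hp : Forces p (Stmt.mem x A)) : Forces q (Stmt.mem x A) :=
  fun r hr => hp r (hr.trans h)

/-- One condition decides all values of a function on a countable ordinal, so it forces the range to
be that of a ground model function. -/
theorem addsNoSmallSets_of_distributive
    (hP : ∀ (J : Type) [Countable J] (D : J → P → Prop), (∀ j q r, r ≤ q → D j q → D j r) →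
      ∀ p, (∀ j, ∀ q ≤ p, ∃ r ≤ q, D j r) → ∃ r ≤ p, ∀ j, D j r) :
    AddsNoSmallSets P (ℵ_ 1) := by
  intro X A α hα f p
  have : Countable α.ToType := by
    rw [← mk_le_aleph0_iff, mk_toType, ← Order.lt_succ_iff, succ_aleph0]
    exact Cardinal.lt_ord.1 hα
  simp only [forces_imp, Stmt.isSurjection, Stmt.inGround, forces_and, forces_all, forces_ex,
    Stmt.iff, forces_ground]
  rintro q - ⟨htot, hran, hfun, hsurj⟩ q' hq'
  obtain ⟨r, hr, hD⟩ := hP α.ToType (fun d r => ∃ x, Forces r (Stmt.mem (d, x) f))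
    (fun d q r hrq h => h.imp fun x hx => forces_mem_mono hrq hx) q'
    (fun d s hs => htot d s (hs.trans hq'))
  choose y hy using hD
  refine ⟨r, hr, range y, fun x => ⟨fun s hs hx => ?_, ?_⟩⟩
  · obtain ⟨t, ht, d, hd⟩ := hsurj x s (hs.trans (hr.trans hq')) hx s le_rfl
    exact ⟨d, hfun d (y d) x t (ht.trans (hs.trans (hr.trans hq')))
      ⟨forces_mem_mono (ht.trans hs) (hy d), hd⟩⟩
  · rintro s hs ⟨d, rfl⟩
    exact hran d (y d) s (hs.trans (hr.trans hq')) (forces_mem_mono hs (hy d))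

end Forcing

/-! ### The properties of the tree. -/

namespace BinSeq

section
variable {I : Type} [LinearOrder I] {T : Set (BinSeq I)}

theorem len_lt_len_iff {x y z : BinSeq I} (hx : x ≤ z) (hy : y ≤ z) :
    x.len < y.len ↔ x < y :=
  ⟨fun h => lt_of_le_of_len_lt (le_of_le_of_le hx hy h.le) h, len_lt⟩

/-! In the forcing notion `Tᵒᵈ`, stronger conditions are longer sequences. -/

open OrderDual

/-- The name displayed is that of the generic branch: it sends `a` to the node of length `a` in the
generic filter. -/
theorem forces_mem_generic {a : I} {x : T} {p : Tᵒᵈ}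
    (hx : Forces p (Stmt.mem (a, x)
      {q : (I × T) × Tᵒᵈ | ofDual q.2 = q.1.2 ∧ q.1.2.1.len = q.1.1})) :
    x.1.len = a ∧ ∃ r ≤ p, x ≤ ofDual r := by
  obtain ⟨r, hr, s, hrs, hs, hl⟩ := hx p le_rfl
  have hs' : ofDual s = x := hs
  exact ⟨hl, r, hr, hs' ▸ hrs⟩

end

open OrderDual

namespace IsGregory

variable {I : Type} [LinearOrder I] [SuccOrder I] {T : Set (BinSeq I)}

theorem res_mem (hT : IsGregory T) {x : BinSeq I} (hx : x ∈ T) {c : I} (hc : c ≤ x.len) :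
    res x.ext0 c ∈ T :=
  hT.lower (res_le x hc) hx

/-- The predecessors of a node correspond to the predecessors of its length. -/
noncomputable def iioIso (hT : IsGregory T) (x : T) : Iio x ≃o Iio x.1.len where
  toFun y := ⟨y.1.1.len, len_lt y.2⟩
  invFun c := ⟨⟨res x.1.ext0 c.1, hT.res_mem x.2 (le_of_lt c.2)⟩,
    lt_of_le_of_len_lt (res_le _ (le_of_lt c.2)) c.2⟩
  left_inv y := by
    have hy : y.1.1 < x.1 := y.2
    ext1; ext1
    exact eq_of_le_of_le (res_le _ (len_le hy.le)) hy.le rfl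
  right_inv c := rfl
  map_rel_iff' {y z} := by
    have hy : y.1.1 < x.1 := y.2
    have hz : z.1.1 < x.1 := z.2
    exact ⟨fun h => le_of_le_of_le hy.le hz.le h, fun h => len_le h⟩

section
variable [WellFoundedLT I]

theorem isTree (hT : IsGregory T) : IsTree T := fun x =>
  (hT.iioIso x).toRelIsoLT.toRelEmbedding.isWellOrder

theorem hasHeight_iff (hT : IsGregory T) (x : T) (α : Ordinal) :
    HasHeight x α ↔ typein (α := I) (· < ·) x.1.len = α := by
  have h1 : HasHeight x α ↔ Nonempty (Iio x.1.len ≃o α.ToType) :=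
    ⟨fun ⟨e⟩ => ⟨(hT.iioIso x).symm.trans e⟩, fun ⟨e⟩ => ⟨(hT.iioIso x).trans e⟩⟩
  have h2 : Nonempty (Iio x.1.len ≃o α.ToType) ↔
      type (α := Iio x.1.len) (· < ·) = type (α := α.ToType) (· < ·) := by
    rw [type_eq]
    exact ⟨fun ⟨e⟩ => ⟨e.toRelIsoLT⟩, fun ⟨e⟩ => ⟨OrderIso.ofRelIsoLT e⟩⟩
  rw [h1, h2, type_toType]
  exact Iff.of_eq (congrArg (· = α) (type_subrel (α := I) (· < ·) x.1.len))

end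

variable [NoMaxOrder I]

theorem covBy_snoc (hT : IsGregory T) (x : T) (i : Bool) :
    x ⋖ ⟨x.1.snoc i, hT.snoc_mem x.1 x.2 i⟩ := by
  refine ⟨lt_of_le_of_len_lt (le_snoc _ _) (Order.lt_succ _), fun z hxz hz => ?_⟩
  exact absurd (len_lt hz) (not_lt.2 (Order.succ_le_of_lt (len_lt hxz)))

theorem eq_snoc_of_covBy (hT : IsGregory T) {x y : T} (h : x ⋖ y) :
    y.1 = x.1.snoc (y.1.ext0 x.1.len) := by
  have hle := snoc_le h.lt.le (len_lt h.lt)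
  by_contra hne
  exact h.2 (hT.covBy_snoc x _).lt (lt_of_le_of_ne hle fun e => hne (congrArg Subtype.val e).symm)

variable [WellFoundedLT I]

theorem isSplitting (hT : IsGregory T) : IsSplitting T where
  isTree := hT.isTree
  unique_limits x y hlim hxy := by
    -- If `x` were longer, its restriction to the length of `y` would be a predecessor of `x`, hence
    -- of `y`, and too long for that.
    have key : ∀ x y : T, Iio x = Iio y → x.1.len ≤ y.1.len := by
      intro x y hxy
      by_contra! h
      have : (⟨res x.1.ext0 y.1.len, hT.res_mem x.2 h.le⟩ : T) ∈ Iio x :=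
        lt_of_le_of_len_lt (res_le _ h.le) h
      rw [hxy] at this
      exact (len_lt this).ne rfl
    apply Subtype.ext
    refine eq_of_le (le_iff.2 ⟨key x y hxy, fun i hi => ?_⟩)
      (le_antisymm (key x y hxy) (key y x hxy.symm))
    obtain ⟨w, hw, hwx⟩ := hlim ⟨res x.1.ext0 i, hT.res_mem x.2 hi.le⟩
      (lt_of_le_of_len_lt (res_le _ hi.le) hi)
    have hwy : w ∈ Iio y := hxy ▸ (show w ∈ Iio x from hwx)
    have hiw : i < w.1.len := len_lt hw
    rw [ext0_eq (le_of_lt hwy : w ≤ y) hiw, ext0_eq (le_of_lt hwx : w ≤ x) hiw]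
  two_succ x := by
    refine ⟨_, _, hT.covBy_snoc x false, hT.covBy_snoc x true, fun h => ?_⟩
    have := congrArg (fun y : T => y.1.ext0 x.1.len) h
    simp only [ext0_snoc] at this
    exact Bool.noConfusion this

variable [IsOmegaOne I]

theorem isFanClosed (hT : IsGregory T) : IsFanClosed T where
  closed n c hc := by
    cases n with
    | zero =>
      obtain ⟨t, ht⟩ := hT.nonempty
      exact ⟨⟨t, ht⟩, fun i => i.elim0⟩
    | succ n => exact ⟨c (Fin.last n), fun i => hc (Fin.le_last i)⟩
  fan δ x hx := by
    have hty : ∀ f, typein (α := I) (· < ·) (x f).1.len = δ f.length := fun f =>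
      (hT.hasHeight_iff _ _).1 (hx.height f)
    have hlen : ∀ f g : List Bool, f.length = g.length → (x f).1.len = (x g).1.len := by
      intro f g h
      rw [← typein_inj (α := I) (· < ·), hty, hty, h]
    have hlt : ∀ f g : List Bool, f.length < g.length → (x f).1.len < (x g).1.len := by
      intro f g h
      rw [← typein_lt_typein (α := I) (· < ·), hty, hty]
      exact hx.strictMono h
    -- Two successors in the fan have equal length; a common extension would make them equal, and
    -- their infimum would be no shorter than they are.
    have hscheme : IsScheme fun f => (x f).1 := by
      refine ⟨fun f i => ?_, fun f z h0 h1 => ?_⟩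
      · cases i
        · exact (hx.inf f).1 (mem_insert _ _)
        · exact (hx.inf f).1 (mem_insert_of_mem _ rfl)
      · have e : x (f ++ [false]) = x (f ++ [true]) :=
          Subtype.ext (eq_of_le_of_le h0 h1 (hlen _ _ (by simp)))
        have hle : x (f ++ [false]) ≤ x f := (hx.inf f).2 (by
          rw [← e]
          rintro _ (rfl | rfl) <;> exact le_rfl)
        exact absurd (len_le hle) (not_le.2 (hlt _ _ (by simp)))
    let s : Set I := {c | ∀ f, (x f).1.len < c}
    have hs : s.Nonempty := by
      obtain ⟨b, hb⟩ := IsOmegaOne.exists_gt_of_countable (range fun f => (x f).1.len)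
        (countable_range _)
      exact ⟨b, fun f => hb _ ⟨f, rfl⟩⟩
    obtain ⟨b, u, hu, -, hbu⟩ := hT.exists_limit (fun f => (x f).1) hscheme (fun f => (x f).2)
      -- All branches converge to this same level, because lengths in a fan depend only on
      -- `f.length`.
      (wellFounded_lt.min s hs) (wellFounded_lt.min_mem s hs) (fun b a ha => by
        have ha' : a ∉ s := fun h => wellFounded_lt.not_lt_min s h ha
        simp only [s, mem_ofPred_eq, not_forall, not_lt] at ha'
        obtain ⟨f, hf⟩ := ha'
        exact ⟨f.length + 1, hf.trans_lt (hlt _ _ (by simp [length_pref]))⟩)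
    exact ⟨b, ⟨u, hu⟩, fun n => hbu n⟩

theorem isBranch_hasOrderType (hT : IsGregory T) {B : Set T} (hB : IsBranch B) :
    ∃ α < (ℵ_ 1).ord, HasOrderType B α := by
  classical
  have htot : ∀ y ∈ B, ∀ z ∈ B, y ≤ z ∨ z ≤ y := fun y hy z hz => hB.1.total hy hz
  have hbd : ∃ c, ∀ y ∈ B, y.1.len ≤ c := by
    by_contra! hcon
    -- A chain of unbounded lengths would define a function on all of `I` whose restrictions lie in
    -- `T`.
    choose y hyB hy using hcon
    obtain ⟨c, hc⟩ := hT.no_branch fun i => (y i).1.ext0 i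
    refine hc (hT.lower (le_iff.2 ⟨(hy c).le, fun i hi => ?_⟩) (y c).2)
    refine Eq.trans ?_ (ext0_res hi).symm
    rcases htot _ (hyB i) _ (hyB c) with h | h
    · exact ext0_eq h (hy i)
    · exact (ext0_eq h (lt_trans hi (hy c))).symm
  obtain ⟨c, hc⟩ := hbd
  have hle : ∀ y z : B, y ≤ z ↔ y.1.1.len ≤ z.1.1.len := by
    intro y z
    refine ⟨fun h => len_le h, fun h => ?_⟩
    rcases htot _ y.2 _ z.2 with h' | h'
    · exact h'
    · exact (Subtype.ext (eq_of_le h' (le_antisymm (len_le h') h)) : z.1 = y.1).ge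
  let e : B ↪o I := OrderEmbedding.ofMapLEIff (fun y => y.1.1.len) fun y z => (hle y z).symm
  have : IsWellOrder B (· < ·) := e.ltEmbedding.isWellOrder
  have hcount : #B ≤ ℵ₀ := by
    have : Countable (Iic c) := (IsOmegaOne.countable_Iic c).to_subtype
    have hinj : Function.Injective fun y : B => (⟨e y, hc _ y.2⟩ : Iic c) :=
      fun y z h => e.injective (congrArg Subtype.val h)
    exact mk_le_aleph0_iff.2 hinj.countable
  refine ⟨type (α := B) (· < ·), ?_, ?_⟩
  · rw [Cardinal.lt_ord, card_type]
    exact hcount.trans_lt (by simp)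
  · obtain ⟨r⟩ := type_eq.1 (type_toType (type (α := B) (· < ·))).symm
    exact ⟨OrderIso.ofRelIsoLT r⟩

theorem isCardTree (hT : IsGregory T) : IsCardTree T (ℵ_ 2) (ℵ_ 1) where
  isTree := hT.isTree
  branch_lt _ hB := hT.isBranch_hasOrderType hB
  succ_lt x := by
    have hinj : Function.Injective fun y : {y : T // x ⋖ y} => y.1.1.ext0 x.1.len := by
      intro y z h
      apply Subtype.ext
      apply Subtype.ext
      rw [hT.eq_snoc_of_covBy y.2, hT.eq_snoc_of_covBy z.2]
      exact congrArg _ h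
    refine (mk_le_of_injective hinj).trans_lt ?_
    rw [mk_bool]
    exact (natCast_lt_aleph0 (n := 2)).trans_le (aleph0_le_aleph 2)

theorem forces_enumeratesBranch (hT : IsGregory T) (p : Tᵒᵈ) :
    Forces p (Stmt.enumeratesBranch
      {q : (I × T) × Tᵒᵈ | ofDual q.2 = q.1.2 ∧ q.1.2.1.len = q.1.1}) := by
  have hmem : ∀ (x : T) (q : Tᵒᵈ), x ≤ ofDual q → Forces q (Stmt.mem (x.1.len, x)
      {q : (I × T) × Tᵒᵈ | ofDual q.2 = q.1.2 ∧ q.1.2.1.len = q.1.1}) :=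
    fun x q hxq r hr => ⟨r, le_rfl, toDual x, le_trans hr hxq, rfl, rfl⟩
  have hext : ∀ (q : Tᵒᵈ) (a : I), ∃ r ≤ q, a < (ofDual r).1.len := by
    intro q a
    obtain ⟨y, hy, hqy, hl⟩ := hT.exists_extension_lt_len (ofDual q).2 a
    exact ⟨toDual ⟨y, hy⟩, hqy, hl⟩
  have hcommon : ∀ {a b : I} {x y : T} {q : Tᵒᵈ},
      Forces q (Stmt.mem (a, x)
        {q : (I × T) × Tᵒᵈ | ofDual q.2 = q.1.2 ∧ q.1.2.1.len = q.1.1}) →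
      Forces q (Stmt.mem (b, y)
        {q : (I × T) × Tᵒᵈ | ofDual q.2 = q.1.2 ∧ q.1.2.1.len = q.1.1}) →
      x.1.len = a ∧ y.1.len = b ∧ ∃ z : T, x ≤ z ∧ y ≤ z := by
    intro a b x y q hx hy
    obtain ⟨ha, r, hr, hxr⟩ := forces_mem_generic hx
    obtain ⟨hb, s, hs, hys⟩ := forces_mem_generic (forces_mem_mono hr hy)
    exact ⟨ha, hb, ofDual s, hxr.trans hs, hys⟩
  simp only [Stmt.enumeratesBranch, forces_and, forces_all, forces_ex, forces_imp, forces_ground]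
  refine ⟨fun a q hq => ?_, fun a x y q hq h => ?_, fun a b x y q hq h => ?_,
    fun x q hq h q' hq' => ?_⟩
  · obtain ⟨r, hr, hl⟩ := hext q a
    exact ⟨r, hr, ⟨res (ofDual r).1.ext0 a, hT.res_mem (ofDual r).2 hl.le⟩,
      hmem ⟨res (ofDual r).1.ext0 a, hT.res_mem (ofDual r).2 hl.le⟩ r (res_le _ hl.le)⟩
  · obtain ⟨ha, hb, z, hxz, hyz⟩ := hcommon h.1 h.2
    exact Subtype.ext (eq_of_le_of_le hxz hyz (ha.trans hb.symm))
  · obtain ⟨ha, hb, z, hxz, hyz⟩ := hcommon h.2.1 h.2.2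
    exact (len_lt_len_iff hxz hyz).1 (by rw [ha, hb]; exact h.1)
  · obtain ⟨r, hr, hl⟩ := hext q' x.1.len
    let y : T := ⟨res (ofDual r).1.ext0 x.1.len, hT.res_mem (ofDual r).2 hl.le⟩
    have hy := hmem y r (res_le _ hl.le)
    -- A node comparable with the whole generic branch is comparable with the value at its own
    -- length, hence equal to it.
    have hxy : x = y := by
      rcases h x.1.len y r (hr.trans hq') hy with h' | h'
      · exact Subtype.ext (eq_of_le h' rfl)
      · exact (Subtype.ext (eq_of_le h' rfl)).symm
    exact ⟨r, hr, x.1.len, by rw [hxy]; exact hy⟩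

theorem distributive (hT : IsGregory T) (J : Type) [Countable J] (D : J → Tᵒᵈ → Prop)
    (hD : ∀ j q r, r ≤ q → D j q → D j r) (p : Tᵒᵈ) (hp : ∀ j, ∀ q ≤ p, ∃ r ≤ q, D j r) :
    ∃ r ≤ p, ∀ j, D j r := by
  -- The void requirement at `none` makes the index type nonempty.
  obtain ⟨h, hh⟩ := hT.exists_generic (J := Option J) (p := (ofDual p).1)
    (fun j _ z => ∃ hz : z ∈ T, ∀ i ∈ j, D i (toDual ⟨z, hz⟩)) (ofDual p).2
    (by
      rintro (_ | j) a y hy hpy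
      · exact ⟨y, hy, le_rfl, hy, by simp⟩
      · obtain ⟨r, hr, hrD⟩ := hp j (toDual ⟨y, hy⟩) hpy
        exact ⟨(ofDual r).1, (ofDual r).2, hr, (ofDual r).2, by rintro i ⟨⟩; exact hrD⟩)
  obtain ⟨c, ⟨⟨a, ha⟩, hc⟩, -⟩ := (isClub_closurePoints h).isCofinal (ofDual p).1.len
  obtain ⟨u, hu, hpu, -, hz⟩ := hh c ⟨a, ha⟩ hc
  refine ⟨toDual ⟨u, hu⟩, hpu, fun j => ?_⟩
  obtain ⟨z, hzu, -, hzT, hzD⟩ := hz (some j) a ha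
  exact hD j (toDual ⟨z, hzT⟩) _ hzu (hzD j rfl)

/-- A node of length `c ∈ S` is found whose predecessors force elements of `C` cofinally often below
`c`. As `C` is closed, the node forces `c ∈ C`. -/
theorem forces_isStationary (hT : IsGregory T) {S : Set I} (hS : IsStationary S) (p : Tᵒᵈ) :
    Forces p (Stmt.isStationary S) := by
  simp only [Stmt.isStationary, Stmt.isClub, forces_and, forces_all, forces_ex, forces_imp,
    forces_ground]
  rintro C q - ⟨hunb, hcl⟩ q' hq'
  obtain ⟨h, hh⟩ := hT.exists_generic (J := Unit) (p := (ofDual q').1)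
    -- Asking for `b < z.len` keeps `b` below `c`, since the nodes `z` obtained are shorter than
    -- `c`.
    (fun _ a z => ∃ (hz : z ∈ T) (b : I), a < b ∧ b < z.len ∧
      Forces (toDual (⟨z, hz⟩ : T)) (Stmt.mem b C)) (ofDual q').2
    (by
      rintro - a y hy hpy
      obtain ⟨r, hr, b, hab, hb⟩ := hunb (succ a) (toDual ⟨y, hy⟩) (le_trans hpy hq')
      obtain ⟨z, hz, hrz, hl⟩ := hT.exists_extension_lt_len (ofDual r).2 b
      exact ⟨z, hz, le_trans hr hrz, hz, b, (Order.lt_succ a).trans_le hab, hl,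
        forces_mem_mono (p := r) (q := toDual (⟨z, hz⟩ : T)) hrz hb⟩)
  obtain ⟨c, hcS, hc0, hc⟩ := hS (isClub_closurePoints h)
  obtain ⟨u, hu, hqu, hlen, hz⟩ := hh c hc0 hc
  refine ⟨toDual ⟨u, hu⟩, hqu, c, hcS, ?_⟩
  refine hcl c (toDual ⟨u, hu⟩) (le_trans (α := Tᵒᵈ) hqu hq') ⟨hc0, fun a s hs hac t ht => ?_⟩
  obtain ⟨z, hzu, hzc, hzT, b, hab, hbz, hb⟩ := hz () a hac
  exact ⟨t, le_rfl, b, ⟨hab, hbz.trans hzc⟩,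
    forces_mem_mono (p := toDual (⟨z, hzT⟩ : T)) ((ht.trans hs).trans hzu) hb⟩

end IsGregory
end BinSeq

/-! ### The well-order `ω₁` and the conclusion. -/

instance isOmegaOne_toType : IsOmegaOne (ℵ_ 1).ord.ToType := by
  have hc : ∀ a : (ℵ_ 1).ord.ToType, (Iic a).Countable := fun a => by
    have h : (Iio a).Countable := by
      rw [← le_aleph0_iff_set_countable, ← Order.lt_succ_iff, succ_aleph0]
      simpa using mk_Iio_lt a (by simp)
    rw [← Iio_insert]
    exact h.insert a
  refine ⟨hc, fun s hs => ?_⟩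
  by_contra! hcon
  have hcov : (univ : Set (ℵ_ 1).ord.ToType).Countable :=
    (hs.biUnion fun a _ => hc a).mono fun b _ => by
      obtain ⟨a, ha, hba⟩ := hcon b
      exact mem_biUnion ha hba
  rw [← le_aleph0_iff_set_countable, mk_univ, mk_toType, card_ord] at hcov
  exact hcov.not_gt aleph0_lt_aleph_one

end SemiProperTree

theorem proposition2 (h : (2 : Cardinal.{0}) ^ (ℵ_ 0) < (2 : Cardinal.{0}) ^ (ℵ_ 1)) :
    ∃ T : Set (SemiProperTree.BinSeq (Ordinal.omega.{0} 1).ToType),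
      IsLowerSet T ∧
      SemiProperTree.IsSplitting T ∧
      SemiProperTree.IsFanClosed T ∧
      SemiProperTree.IsSemiProper (ℵ_ 2) (ℵ_ 1) T := by
  rw [← Cardinal.ord_aleph]
  have : NoMaxOrder (ℵ_ 1).ord.ToType := Cardinal.noMaxOrder (Cardinal.aleph0_le_aleph 1)
  have : Nonempty (ℵ_ 1).ord.ToType := Ordinal.nonempty_toType_iff.2 fun h0 =>
    (Cardinal.aleph_pos 1).ne' (Cardinal.ord_eq_zero.1 h0)
  let : OrderBot (ℵ_ 1).ord.ToType := WellFoundedLT.toOrderBot _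
  have hmk : #(ℵ_ 1).ord.ToType = ℵ_ 1 := by simp
  rw [Cardinal.aleph_zero] at h
  obtain ⟨T, hT⟩ := SemiProperTree.BinSeq.exists_isGregory (I := (ℵ_ 1).ord.ToType)
    (hmk.trans_le Cardinal.aleph_one_le_continuum) (by rwa [hmk])
  exact ⟨T, hT.lower, hT.isSplitting, hT.isFanClosed,
    { isCardTree := hT.isCardTree
      nonempty := hT.nonempty.to_subtype
      addsBranch := ⟨_, hT.forces_enumeratesBranch⟩
      preservesStationary := fun _ hS p => hT.forces_isStationary hS p
      addsNoSmallSets := SemiProperTree.addsNoSmallSets_of_distributive hT.distributive }⟩
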